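/- Let $p$ be a prime number, let $K$ be a field of characteristic $p$ with $[K:K^p]<\infty$, let $n\ge 0$, and let $S=K[\![x_1,\dots,x_n]\!]$. Then for every $f\in S$ and every integer $d\ge 0$, the ring $R=S[\![y]\!]/(y^{p^d}+f)$ has finite $F$-representation type. That is, $R$ is Noetherian and there exist finitely many finitely generated $R$-modules $M_1,\dots,M_s$ such that for every positive integer $e$ there are nonnegative integers $t_{(e,1)},\dots,t_{(e,s)}$ with $$F_*^e(R)\cong\bigoplus_{j=1}^s M_j^{\oplus t_{(e,j)}}$$ as $R$-modules, where $F_*^e(R)$ is the additive group $R$ on which $r\in R$ acts by $r\cdot a=r^{p^e}a$. -/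

import Mathlib

namespace FFRT

universe u

/-- The `e`-fold iterated Frobenius `r ↦ r ^ (p ^ e)` of a commutative ring in which the prime
`p` is zero. (The hypothesis `(p : R) = 0` is used instead of `CharP R p` so that the zero ring,
which occurs as a quotient by a unit, is allowed.) -/
def iterFrob (p : ℕ) [hp : Fact p.Prime] {R : Type u} [CommRing R] (hR : (p : R) = 0) (e : ℕ) :
    R →+* R where
  toFun r := r ^ p ^ e
  map_one' := one_pow _
  map_mul' a b := mul_pow a b _
  map_zero' := zero_pow (pow_ne_zero e hp.out.ne_zero)
  map_add' a b := by
    obtain ⟨r, hr⟩ := exists_add_pow_prime_pow_eq hp.out a b e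
    rw [hr, hR, zero_mul, zero_mul, zero_mul, add_zero]

/-- `F_*^e M`: the additive group `M` with `R` acting through the `e`-fold Frobenius. -/
def FrobeniusPushforward (p : ℕ) [Fact p.Prime] {R : Type u} [CommRing R] (_hR : (p : R) = 0)
    (_e : ℕ) (M : Type u) : Type u := M

instance (p : ℕ) [Fact p.Prime] {R : Type u} [CommRing R] (hR : (p : R) = 0) (e : ℕ)
    (M : Type u) [AddCommGroup M] : AddCommGroup (FrobeniusPushforward p hR e M) :=
  inferInstanceAs (AddCommGroup M)

instance (p : ℕ) [Fact p.Prime] {R : Type u} [CommRing R] (hR : (p : R) = 0) (e : ℕ)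
    (M : Type u) [AddCommGroup M] [Module R M] : Module R (FrobeniusPushforward p hR e M) :=
  Module.compHom M (iterFrob p hR e)

/-- The action on `F_*^e M` is `r • F_*^e m = F_*^e (r ^ (p ^ e) • m)`. -/
theorem frobeniusPushforward_smul (p : ℕ) [Fact p.Prime] {R : Type u} [CommRing R]
    (hR : (p : R) = 0) (e : ℕ) (M : Type u) [AddCommGroup M] [Module R M] (r : R) (m : M) :
    (r • (show FrobeniusPushforward p hR e M from m) : FrobeniusPushforward p hR e M) =
      (show FrobeniusPushforward p hR e M from (r ^ p ^ e • m : M)) :=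
  rfl

/-- The finitely generated module `M` has finite F-representation type by the finitely generated
modules `N 0, …, N (s - 1)`: for every positive `e`, `F_*^e M` is isomorphic to
`⨁ j, (N j) ^ (t j)` for suitable multiplicities `t j ≥ 0`, depending on `e`. -/
def ModuleHasFFRTBy (p : ℕ) [Fact p.Prime] {R : Type u} [CommRing R] (hR : (p : R) = 0)
    (M : Type u) [AddCommGroup M] [Module R M] {s : ℕ} (N : Fin s → ModuleCat.{u} R) : Prop :=
  Module.Finite R M ∧ (∀ j, Module.Finite R (N j)) ∧
    ∀ e : ℕ, 0 < e → ∃ t : Fin s → ℕ,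
      Nonempty (FrobeniusPushforward p hR e M ≃ₗ[R] ((j : Fin s) → Fin (t j) → N j))

/-- The Noetherian ring `R`, in which the prime `p` is zero, has finite F-representation type:
there are finitely many finitely generated `R`-modules by which `R` has finite F-representation type. -/
def HasFFRT (p : ℕ) [Fact p.Prime] (R : Type u) [CommRing R] : Prop :=
  IsNoetherianRing R ∧ ∃ (hR : (p : R) = 0) (s : ℕ) (N : Fin s → ModuleCat.{u} R), ModuleHasFFRTBy p hR R N

end FFRT

/-! If `f` has nonzero constant term, `y ^ p ^ d + f` is a unit and `R = 0`. Otherwise it is a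
distinguished polynomial, so by Weierstrass division `R` is free over `S` on `1, y, …, y ^ (p ^ d -
1)`. As `y ^ p ^ d = -f` lies in `S`, the `d`-fold Frobenius of `R` factors through a ring map `ψ :
R → S` (`exists_ringHom_iterFrob`). Hence `r ^ p ^ (d + e) = ψ r ^ p ^ e`; since `S` is free of
finite rank over its `p ^ e`-th powers (`FinFreeOverPow.mvPowerSeries`), `F_*^(d+e) R` is a finite
sum of copies of `S` with `R` acting through `ψ`. This module and the `F_*^e R` with `e < d`
suffice. -/

namespace FFRT

universe u

/-! ### Freeness over the subring of `q`-th powers -/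

/-- `A` is free of finite rank over its subring of `q`-th powers, expressed by an additive
equivalence `φ : Aⁿ ≃ A` with `φ (s • c) = s ^ q * φ c`. -/
def FinFreeOverPow (A : Type*) [CommRing A] (q : ℕ) : Prop :=
  ∃ (n : ℕ) (φ : (Fin n → A) ≃+ A), ∀ (s : A) (c : Fin n → A), φ (s • c) = s ^ q * φ c

theorem FinFreeOverPow.of_fintype {A : Type*} [CommRing A] {q : ℕ} {ι : Type*} [Fintype ι]
    (φ : (ι → A) ≃+ A) (h : ∀ (s : A) (c : ι → A), φ (s • c) = s ^ q * φ c) :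
    FinFreeOverPow A q := by
  let e := LinearEquiv.funCongrLeft A A (Fintype.equivFin ι)
  refine ⟨Fintype.card ι, e.toAddEquiv.trans φ, fun s c ↦ ?_⟩
  change φ (e (s • c)) = s ^ q * φ (e c)
  rw [map_smul, h]

theorem FinFreeOverPow.one (A : Type*) [CommRing A] : FinFreeOverPow A 1 :=
  .of_fintype (LinearEquiv.funUnique Unit A A).toAddEquiv fun s c ↦ by simp

theorem FinFreeOverPow.mul {A : Type*} [CommRing A] {q q' : ℕ} (h : FinFreeOverPow A q)
    (h' : FinFreeOverPow A q') : FinFreeOverPow A (q * q') := by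
  obtain ⟨n, φ, hφ⟩ := h
  obtain ⟨m, ψ, hψ⟩ := h'
  let e : (Fin m × Fin n → A) ≃+ (Fin m → Fin n → A) :=
    (LinearEquiv.curry A A (Fin m) (Fin n)).toAddEquiv
  refine .of_fintype ((e.trans (AddEquiv.piCongrRight fun _ ↦ φ)).trans ψ) fun s c ↦ ?_
  change ψ (fun i ↦ φ (s • fun j ↦ c (i, j))) = s ^ (q * q') * ψ fun i ↦ φ fun j ↦ c (i, j)
  simp_rw [hφ, pow_mul, ← hψ]
  rfl

theorem FinFreeOverPow.pow {A : Type*} [CommRing A] {q : ℕ} (h : FinFreeOverPow A q) (e : ℕ) :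
    FinFreeOverPow A (q ^ e) := by
  induction e with
  | zero => simpa using FinFreeOverPow.one A
  | succ e ih => simpa [pow_succ] using ih.mul h

theorem FinFreeOverPow.of_ringEquiv {A B : Type*} [CommRing A] [CommRing B] {q : ℕ} (e : A ≃+* B)
    (h : FinFreeOverPow A q) : FinFreeOverPow B q := by
  obtain ⟨n, φ, hφ⟩ := h
  refine ⟨n, ((AddEquiv.piCongrRight fun _ ↦ e.symm.toAddEquiv).trans φ).trans e.toAddEquiv,
    fun s c ↦ ?_⟩
  change e (φ fun i ↦ e.symm (s * c i)) = s ^ q * e (φ fun i ↦ e.symm (c i))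
  have : (fun i ↦ e.symm (s * c i)) = e.symm s • fun i ↦ e.symm (c i) := by
    ext i; simp
  rw [this, hφ, map_mul, map_pow, e.apply_symm_apply]

/-- This is where `[K : K^p] < ∞` enters: coordinates in a `K^p`-basis of `K` are moved to `K` along
the isomorphism `K ≃ K^p`. -/
theorem FinFreeOverPow.of_finite_frobenius {K : Type*} [Field K] (p : ℕ) [Fact p.Prime]
    [CharP K p] (hK : Module.Finite (frobenius K p).fieldRange K) : FinFreeOverPow K p := by
  let b := Module.finBasis (frobenius K p).fieldRange K
  let e : K ≃+* (frobenius K p).fieldRange := (frobenius K p).rangeRestrictFieldEquiv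
  refine ⟨_, (AddEquiv.piCongrRight fun _ ↦ e.toAddEquiv).trans b.equivFun.symm.toAddEquiv,
    fun s c ↦ ?_⟩
  change b.equivFun.symm (fun i ↦ e (s * c i)) = s ^ p * b.equivFun.symm fun i ↦ e (c i)
  have : (fun i ↦ e (s * c i)) = e s • fun i ↦ e (c i) := by
    ext i; simp
  rw [this, map_smul]
  rfl

/-- The coefficients of `s ^ p` in characteristic `p`, in the shape needed for products. -/
theorem coeff_pow_char_mul {A : Type*} [CommRing A] (p : ℕ) [hp : Fact p.Prime] [CharP A p]
    (s t : PowerSeries A) (n : ℕ) :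
    PowerSeries.coeff n (s ^ p * t) = ∑ x ∈ Finset.HasAntidiagonal.antidiagonal (n / p),
      PowerSeries.coeff x.1 s ^ p * PowerSeries.coeff (p * x.2 + n % p) t := by
  have hs : ∀ j, PowerSeries.coeff j (s ^ p) =
      if p ∣ j then PowerSeries.coeff (j / p) s ^ p else 0 := by
    intro j
    have := MvPowerSeries.map_frobenius_expand p hp.out.ne_zero (f := s)
    change PowerSeries.map (frobenius A p) (PowerSeries.expand p hp.out.ne_zero s) = _ at this
    rw [← this, PowerSeries.coeff_map, PowerSeries.coeff_expand, frobenius_def]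
    split_ifs
    · rfl
    · exact zero_pow hp.out.ne_zero
  rw [PowerSeries.coeff_mul]
  symm
  -- Only pairs whose first entry is divisible by `p` contribute; the second entry is then congruent
  -- to `n` modulo `p`.
  refine Finset.sum_of_injOn (fun x ↦ (p * x.1, p * x.2 + n % p)) ?_ ?_ ?_ ?_
  · rintro ⟨a, b⟩ - ⟨a', b'⟩ - h
    simpa [hp.out.ne_zero] using h
  · rintro ⟨a, b⟩ h
    simp only [Finset.mem_coe, Finset.HasAntidiagonal.mem_antidiagonal] at h ⊢
    rw [← add_assoc, ← mul_add, h, Nat.div_add_mod]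
  · rintro ⟨a, b⟩ h h'
    rw [hs]
    split_ifs with hd
    · obtain ⟨a, rfl⟩ := hd
      refine (h' ⟨(a, b / p), ?_, ?_⟩).elim
      · simp only [Finset.HasAntidiagonal.mem_antidiagonal, Finset.mem_coe] at h ⊢
        rw [← h, Nat.mul_add_div hp.out.pos]
      · simp only [Finset.HasAntidiagonal.mem_antidiagonal] at h
        simp only [Prod.mk.injEq, true_and]
        rw [← h, Nat.mul_add_mod, Nat.div_add_mod]
    · rw [zero_mul]
  · rintro ⟨a, b⟩ -
    rw [hs, if_pos (dvd_mul_right p a), Nat.mul_div_cancel_left _ hp.out.pos]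

/-- The additive equivalence `A⟦X⟧^(p × ι) ≃ A⟦X⟧` whose value at `c` has as coefficient of
`X ^ (p * m + a)` the image under `φ` of the coefficients of `X ^ m` in the family `c (a, ·)`. -/
noncomputable def interleave {A : Type*} [CommRing A] {ι : Type*} (φ : (ι → A) ≃+ A) (p : ℕ)
    [NeZero p] : (Fin p × ι → PowerSeries A) ≃+ PowerSeries A where
  toFun c := PowerSeries.mk fun n ↦
    φ fun i ↦ PowerSeries.coeff (n / p) (c (⟨n % p, Nat.mod_lt _ (NeZero.pos p)⟩, i))
  invFun s x := PowerSeries.mk fun m ↦ φ.symm (PowerSeries.coeff (p * m + x.1) s) x.2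
  left_inv c := by
    ext ⟨a, i⟩ m
    simp [Nat.mul_add_div (NeZero.pos p), Nat.div_eq_of_lt a.isLt, Nat.mod_eq_of_lt a.isLt]
  right_inv s := by
    ext n
    simp [Nat.div_add_mod]
  map_add' c c' := by
    ext n
    simp only [PowerSeries.coeff_mk, Pi.add_apply, map_add]
    rw [← map_add]
    rfl

/-- If the `b i` form a basis of `A` over `p`-th powers, the `b i * X ^ a` with `a < p` form one of
`A⟦X⟧`. -/
theorem FinFreeOverPow.powerSeries {A : Type*} [CommRing A] (p : ℕ) [hp : Fact p.Prime] [CharP A p]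
    (h : FinFreeOverPow A p) : FinFreeOverPow (PowerSeries A) p := by
  obtain ⟨n, φ, hφ⟩ := h
  have : NeZero p := ⟨hp.out.ne_zero⟩
  refine .of_fintype (interleave φ p) fun s c ↦ ?_
  ext k
  rw [coeff_pow_char_mul]
  simp only [interleave, AddEquiv.coe_mk, Equiv.coe_fn_mk, PowerSeries.coeff_mk, Pi.smul_apply,
    smul_eq_mul, PowerSeries.coeff_mul]
  have hm : ∀ x : ℕ × ℕ, (p * x.2 + k % p) % p = k % p := fun x ↦ by
    rw [Nat.mul_add_mod, Nat.mod_mod]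
  have hd : ∀ x : ℕ × ℕ, (p * x.2 + k % p) / p = x.2 := fun x ↦ by
    rw [Nat.mul_add_div hp.out.pos, Nat.div_eq_of_lt (Nat.mod_lt _ hp.out.pos), add_zero]
  simp_rw [hm, hd, ← hφ, ← map_sum]
  congr 1
  ext i
  simp

theorem FinFreeOverPow.mvPowerSeries {K : Type*} [Field K] (p : ℕ) [Fact p.Prime] [CharP K p]
    (h : FinFreeOverPow K p) (n : ℕ) : FinFreeOverPow (MvPowerSeries (Fin n) K) p := by
  induction n with
  | zero => exact h.of_ringEquiv (MvPowerSeries.isEmptyEquiv (Fin 0) K).toRingEquiv.symm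
  | succ n ih =>
    have := charP_of_injective_algebraMap
      (algebraMap K (MvPowerSeries (Fin n) K)).injective p
    exact (ih.powerSeries p).of_ringEquiv (MvPowerSeries.finSuccEquiv K n).toRingEquiv.symm

/-! ### The ideal generated by the variables -/

theorem mem_span_range_X {K : Type*} [CommRing K] {n : ℕ} (f : MvPowerSeries (Fin n) K)
    (hf : MvPowerSeries.constantCoeff f = 0) :
    f ∈ Ideal.span (Set.range (MvPowerSeries.X : Fin n → MvPowerSeries (Fin n) K)) := by
  induction n with
  | zero =>
    convert! Ideal.zero_mem _
    ext m
    rw [Subsingleton.elim m 0]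
    simpa using hf
  | succ n ih =>
    let e := MvPowerSeries.finSuccEquiv K n
    let ψ : MvPowerSeries (Fin n) K →+* MvPowerSeries (Fin (n + 1)) K :=
      -- `ψ` embeds the series in the last `n` variables; the induction splits off the part
      -- divisible by `X 0`.
      e.symm.toRingEquiv.toRingHom.comp PowerSeries.C
    have hψ : ∀ j, ψ (MvPowerSeries.X j) = MvPowerSeries.X j.succ := fun j ↦ by
      change e.symm (PowerSeries.C _) = _
      rw [AlgEquiv.symm_apply_eq, MvPowerSeries.finSuccEquiv_X_succ]
    have hX : e.symm PowerSeries.X = MvPowerSeries.X 0 := by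
      rw [AlgEquiv.symm_apply_eq, MvPowerSeries.finSuccEquiv_X_zero]
    have h0 := ih (PowerSeries.constantCoeff (e f)) <| by
      rw [← MvPowerSeries.coeff_zero_eq_constantCoeff_apply,
        ← PowerSeries.coeff_zero_eq_constantCoeff_apply, MvPowerSeries.coeff_coeff_finSuccEquiv]
      simpa using hf
    have hf' : f = MvPowerSeries.X 0 *
        e.symm (PowerSeries.mk fun k ↦ PowerSeries.coeff (k + 1) (e f)) +
        ψ (PowerSeries.constantCoeff (e f)) := by
      apply e.injective
      rw [map_add, map_mul, ← hX]
      change _ = e (e.symm _) * e (e.symm _) + e (e.symm _)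
      simp only [AlgEquiv.apply_symm_apply]
      exact PowerSeries.eq_X_mul_shift_add_const _
    rw [hf']
    refine add_mem (Ideal.mul_mem_right _ _ (Ideal.subset_span ⟨0, rfl⟩)) ?_
    have := Ideal.mem_map_of_mem ψ h0
    rw [Ideal.map_span, ← Set.range_comp] at this
    refine Ideal.span_mono ?_ this
    rintro _ ⟨j, rfl⟩
    exact ⟨j.succ, (hψ j).symm⟩

/-! ### Rings with a basis of powers over `S` -/

section PowerBasis

variable {S R : Type u} [CommRing S] [CommRing R] [Algebra S R] {m : ℕ}

/-- The additive equivalence `(s_{i,k}) ↦ ∑ i, φ (s_i) b_i`. -/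
noncomputable def basisSumEquiv (b : Module.Basis (Fin m) S R) {n : ℕ} (φ : (Fin n → S) ≃+ S) :
    (Fin m → Fin n → S) ≃+ R :=
  (AddEquiv.piCongrRight fun _ ↦ φ).trans b.equivFun.symm.toAddEquiv

theorem basisSumEquiv_apply (b : Module.Basis (Fin m) S R) {n : ℕ} (φ : (Fin n → S) ≃+ S)
    (c : Fin m → Fin n → S) : basisSumEquiv b φ c = ∑ i, φ (c i) • b i :=
  b.equivFun_symm_apply _

theorem basisSumEquiv_smul (b : Module.Basis (Fin m) S R) {n q : ℕ} (φ : (Fin n → S) ≃+ S)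
    (hφ : ∀ (s : S) (c : Fin n → S), φ (s • c) = s ^ q * φ c) (s : S) (c : Fin m → Fin n → S) :
    basisSumEquiv b φ (s • c) = algebraMap S R s ^ q * basisSumEquiv b φ c := by
  simp_rw [basisSumEquiv_apply, Pi.smul_apply, hφ, Finset.mul_sum, ← map_pow, ← Algebra.smul_def,
    mul_smul]

variable (p : ℕ) [hp : Fact p.Prime]

/-- The ring of `p ^ d`-th powers of `R` lies in `S` when `R` has an `S`-basis of powers of an
element whose `p ^ d`-th power is in `S`. -/
theorem iterFrob_range_le (hR : (p : R) = 0) (d : ℕ) (b : Module.Basis (Fin m) S R) (y : R)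
    (hb : ∀ i, b i = y ^ (i : ℕ)) (g : S) (hy : y ^ p ^ d = algebraMap S R g) (r : R) :
    iterFrob p hR d r ∈ (algebraMap S R).range := by
  rw [← b.sum_repr r, map_sum]
  refine sum_mem fun i _ ↦ ⟨b.repr r i ^ p ^ d * g ^ (i : ℕ), ?_⟩
  change _ = (b.repr r i • b i) ^ p ^ d
  rw [Algebra.smul_def, mul_pow, hb, ← pow_mul, mul_comm (i : ℕ), pow_mul, hy, map_mul, map_pow,
    map_pow]

theorem exists_ringHom_iterFrob (hR : (p : R) = 0) (d : ℕ) (hm : 0 < m)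
    (b : Module.Basis (Fin m) S R) (y : R) (hb : ∀ i, b i = y ^ (i : ℕ)) (g : S)
    (hy : y ^ p ^ d = algebraMap S R g) :
    ∃ ψ : R →+* S, (∀ r, algebraMap S R (ψ r) = r ^ p ^ d) ∧
      ∀ s, ψ (algebraMap S R s) = s ^ p ^ d := by
  have : NeZero m := ⟨hm.ne'⟩
  -- The coordinate at `b 0` recovers `s`; this needs `0 < m`.
  have hinj : Function.Injective (algebraMap S R) := by
    rw [injective_iff_map_eq_zero]
    intro s hs
    have h0 : s • b 0 = 0 := by rw [Algebra.smul_def, hs, zero_mul]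
    simpa using congrArg (b.repr · 0) h0
  let e := RingEquiv.ofBijective (algebraMap S R).rangeRestrict
    ⟨fun _ _ h ↦ hinj (congrArg Subtype.val h), (algebraMap S R).rangeRestrict_surjective⟩
  let ψ := e.symm.toRingHom.comp ((iterFrob p hR d).codRestrict (algebraMap S R).range
    (iterFrob_range_le p hR d b y hb g hy))
  have hψ : ∀ r, algebraMap S R (ψ r) = r ^ p ^ d := fun r ↦ congrArg Subtype.val
    (e.apply_symm_apply ⟨iterFrob p hR d r, iterFrob_range_le p hR d b y hb g hy r⟩)
  exact ⟨ψ, hψ, fun s ↦ hinj (by rw [hψ, map_pow])⟩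

/-- The products of the basis of `S` over `p ^ e`-th powers with the `b i` generate, already with
scalars from `S`. -/
theorem finite_frobeniusPushforward (hR : (p : R) = 0) (e : ℕ) (b : Module.Basis (Fin m) S R)
    (hS : FinFreeOverPow S (p ^ e)) : Module.Finite R (FrobeniusPushforward p hR e R) := by
  obtain ⟨n, φ, hφ⟩ := hS
  let v : Fin m × Fin n → FrobeniusPushforward p hR e R :=
    fun x ↦ (φ (Pi.single x.2 1) • b x.1 : R)
  refine .of_surjective (Fintype.linearCombination R v) fun r ↦ ?_
  obtain ⟨c, hc⟩ := (basisSumEquiv b φ).surjective r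
  refine ⟨fun x ↦ algebraMap S R (c x.1 x.2), ?_⟩
  rw [Fintype.linearCombination_apply]
  change ∑ x : Fin m × Fin n, (algebraMap S R (c x.1 x.2) ^ p ^ e *
    (φ (Pi.single x.2 1) • b x.1) : R) = r
  rw [← hc, basisSumEquiv_apply, Fintype.sum_prod_type]
  refine Finset.sum_congr rfl fun i _ ↦ ?_
  have : φ (c i) = ∑ k, c i k ^ p ^ e * φ (Pi.single k 1) := by
    conv_lhs => rw [pi_eq_sum_univ' (c i), map_sum]
    refine Finset.sum_congr rfl fun k _ ↦ ?_
    rw [← hφ]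
  rw [this, Finset.sum_smul]
  refine Finset.sum_congr rfl fun k _ ↦ ?_
  rw [mul_smul, Algebra.smul_def (c i k ^ p ^ e), map_pow]

theorem finite_compHom_of_finFreeOverPow (q : ℕ) (ψ : R →+* S)
    (hψ : ∀ s, ψ (algebraMap S R s) = s ^ q) (hS : FinFreeOverPow S q) :
    letI := Module.compHom S ψ
    Module.Finite R S := by
  let _ := Module.compHom S ψ
  obtain ⟨n, φ, hφ⟩ := hS
  refine .of_surjective (Fintype.linearCombination R fun k : Fin n ↦ φ (Pi.single k 1))
    fun s ↦ ?_
  obtain ⟨c, rfl⟩ := φ.surjective s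
  refine ⟨fun k ↦ algebraMap S R (c k), ?_⟩
  rw [Fintype.linearCombination_apply, pi_eq_sum_univ' c, map_sum]
  refine Finset.sum_congr rfl fun k _ ↦ ?_
  change ψ _ * _ = _
  rw [hψ, ← hφ, ← pi_eq_sum_univ']

/-- For large `e`, `F_*^e R` is a direct sum of copies of `S`, on which `R` acts through `ψ`. -/
theorem exists_frobeniusPushforward_equiv (hR : (p : R) = 0) (d e : ℕ)
    (b : Module.Basis (Fin m) S R) (ψ : R →+* S) (hψ : ∀ r, algebraMap S R (ψ r) = r ^ p ^ d)
    (hS : FinFreeOverPow S (p ^ e)) :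
    letI := Module.compHom S ψ
    ∃ k : ℕ, Nonempty (FrobeniusPushforward p hR (d + e) R ≃ₗ[R] (Fin k → S)) := by
  let _ := Module.compHom S ψ
  obtain ⟨n, φ, hφ⟩ := hS
  let E : (Fin m → Fin n → S) ≃ₗ[R] FrobeniusPushforward p hR (d + e) R :=
    { basisSumEquiv b φ with
      map_smul' := fun r c ↦ by
        change basisSumEquiv b φ (ψ r • c) = r ^ p ^ (d + e) * basisSumEquiv b φ c
        rw [basisSumEquiv_smul b φ hφ, hψ, ← pow_mul, pow_add] }
  exact ⟨_, ⟨E.symm ≪≫ₗ (LinearEquiv.curry R S (Fin m) (Fin n)).symm ≪≫ₗ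
    LinearEquiv.funCongrLeft R S finProdFinEquiv.symm⟩⟩

theorem exists_multiplicities {s : ℕ} (N : Fin s → ModuleCat.{u} R) (j₀ : Fin s)
    {M : ModuleCat.{u} R} (hN : N j₀ = M) {X : Type u} [AddCommGroup X] [Module R X] {k : ℕ}
    (h : X ≃ₗ[R] (Fin k → M)) :
    ∃ t : Fin s → ℕ, Nonempty (X ≃ₗ[R] ((j : Fin s) → Fin (t j) → N j)) := by
  subst hN
  -- Replacing `k` by `t j₀` makes the two index types agree definitionally, so no casts arise.
  obtain ⟨t, rfl, ht⟩ : ∃ t : Fin s → ℕ, t j₀ = k ∧ ∀ j ≠ j₀, t j = 0 :=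
    ⟨Pi.single j₀ k, Pi.single_eq_same _ _, fun j hj ↦ Pi.single_eq_of_ne hj _⟩
  let π : ((j : Fin s) → Fin (t j) → N j) →ₗ[R] (Fin (t j₀) → N j₀) := LinearMap.proj j₀
  refine ⟨t, ⟨h ≪≫ₗ (LinearEquiv.ofBijective π ⟨fun x y hxy ↦ ?_, fun x ↦ ?_⟩).symm⟩⟩
  · ext j i
    by_cases hj : j = j₀
    · subst hj
      exact congrFun hxy i
    · exact (Fin.cast (ht j hj) i).elim0
  · exact ⟨Function.update 0 j₀ x, Function.update_self _ _ _⟩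

theorem hasFFRT_of_powerBasis [IsNoetherianRing R] (hR : (p : R) = 0) (d : ℕ) (hm : 0 < m)
    (b : Module.Basis (Fin m) S R) (y : R) (hb : ∀ i, b i = y ^ (i : ℕ)) (g : S)
    (hy : y ^ p ^ d = algebraMap S R g) (hS : FinFreeOverPow S p) : HasFFRT p R := by
  obtain ⟨ψ, hψ, hψ'⟩ := exists_ringHom_iterFrob p hR d hm b y hb g hy
  let _ := Module.compHom S ψ
  have hfin : Module.Finite R S := finite_compHom_of_finFreeOverPow (p ^ d) ψ hψ' (hS.pow d)
  let F (e : ℕ) : ModuleCat.{u} R := .of R (FrobeniusPushforward p hR e R)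
  -- The small pushforwards `F_*^e R`, `e < d`, followed by `S` with `R` acting through `ψ`.
  let N : Fin (d + 1) → ModuleCat.{u} R :=
    Fin.lastCases (motive := fun _ ↦ ModuleCat.{u} R) (.of R S) fun j ↦ F j
  have hlast : N (Fin.last d) = .of R S := Fin.lastCases_last
  have hcast (j : Fin d) : N j.castSucc = F j := Fin.lastCases_castSucc j
  refine ⟨inferInstance, hR, d + 1, N, inferInstance, fun j ↦ ?_, fun e _ ↦ ?_⟩
  · induction j using Fin.lastCases with
    | last => rw [hlast]; exact hfin
    | cast j => rw [hcast]; exact finite_frobeniusPushforward p hR j b (hS.pow j)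
  · rcases lt_or_ge e d with he | he
    · exact exists_multiplicities N (Fin.castSucc ⟨e, he⟩) (hcast ⟨e, he⟩)
        (LinearEquiv.funUnique (Fin 1) R (F e)).symm
    · obtain ⟨e, rfl⟩ := Nat.exists_eq_add_of_le he
      obtain ⟨k, ⟨h⟩⟩ := exists_frobeniusPushforward_equiv p hR d e b ψ hψ (hS.pow e)
      exact exists_multiplicities N (Fin.last d) hlast h

end PowerBasis

/-! ### The zero ring and the main theorem -/

theorem hasFFRT_of_subsingleton (p : ℕ) [Fact p.Prime] (R : Type u) [CommRing R]
    [Subsingleton R] : HasFFRT p R := by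
  refine ⟨inferInstance, Subsingleton.elim _ _, 0, Fin.elim0, inferInstance, fun j ↦ j.elim0,
    fun e _ ↦ ⟨Fin.elim0, ⟨?_⟩⟩⟩
  have : Subsingleton (FrobeniusPushforward p (Subsingleton.elim (p : R) 0) e R) :=
    inferInstanceAs (Subsingleton R)
  exact 0

end FFRT

theorem theorem5 {K : Type*} [Field K] (p : ℕ) [Fact p.Prime] [CharP K p]
    (hK : Module.Finite (frobenius K p).fieldRange K) (n d : ℕ)
    (f : MvPowerSeries (Fin n) K) :
    FFRT.HasFFRT p
      (PowerSeries (MvPowerSeries (Fin n) K) ⧸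
        Ideal.span {(PowerSeries.X ^ p ^ d + PowerSeries.C f :
          PowerSeries (MvPowerSeries (Fin n) K))}) := by
  by_cases hf : MvPowerSeries.constantCoeff f = 0
  · have hq : p ^ d ≠ 0 := pow_ne_zero d (Fact.out : p.Prime).ne_zero
    let G : Polynomial (MvPowerSeries (Fin n) K) := Polynomial.X ^ p ^ d + Polynomial.C f
    have hG : G.Monic := Polynomial.monic_X_pow_add_C f hq
    have hdeg : G.natDegree = p ^ d := Polynomial.natDegree_X_pow_add_C
    -- The lower coefficients of `G` are `f` or `0`, both in the ideal of the variables, so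
    -- Weierstrass division identifies the quotient with `AdjoinRoot G`.
    have hdist : G.IsDistinguishedAt
        (Ideal.span (Set.range (MvPowerSeries.X : Fin n → MvPowerSeries (Fin n) K))) := by
      refine ⟨⟨fun {k} hk ↦ ?_⟩, hG⟩
      rw [hdeg] at hk
      rw [Polynomial.coeff_add, Polynomial.coeff_X_pow, if_neg hk.ne, zero_add,
        Polynomial.coeff_C]
      split_ifs
      · exact FFRT.mem_span_range_X f hf
      · exact Ideal.zero_mem _
    have hcoe : (G : PowerSeries (MvPowerSeries (Fin n) K)) =
        PowerSeries.X ^ p ^ d + PowerSeries.C f := by simp [G]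
    rw [← hcoe]
    let E : AdjoinRoot G ≃ₐ[MvPowerSeries (Fin n) K] _ := hdist.algEquivQuotient
    have hp : (p : MvPowerSeries (Fin n) K) = 0 := by
      rw [← map_natCast (algebraMap K _), CharP.cast_eq_zero, map_zero]
    let B := AdjoinRoot.powerBasis' hG
    refine FFRT.hasFFRT_of_powerBasis p ?_ d (m := B.dim) ?_ (B.basis.map E.toLinearEquiv)
      (E (AdjoinRoot.root G)) (fun i ↦ ?_) (-f) ?_ (.mvPowerSeries p (.of_finite_frobenius p hK) n)
    · rw [← map_natCast (algebraMap (MvPowerSeries (Fin n) K) _), hp, map_zero]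
    · rw [AdjoinRoot.powerBasis'_dim, hdeg]
      exact hq.bot_lt
    · rw [Module.Basis.map_apply, B.basis_eq_pow, AdjoinRoot.powerBasis'_gen]
      exact map_pow E (AdjoinRoot.root G) i
    · rw [← map_pow, ← E.commutes]
      congr 1
      have := AdjoinRoot.eval₂_root G
      simp only [G, Polynomial.eval₂_add, Polynomial.eval₂_X_pow, Polynomial.eval₂_C] at this
      rw [map_neg]
      exact eq_neg_of_add_eq_zero_left this
  · have hu : IsUnit (PowerSeries.X ^ p ^ d + PowerSeries.C f :
        PowerSeries (MvPowerSeries (Fin n) K)) := by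
      rw [PowerSeries.isUnit_iff_constantCoeff, MvPowerSeries.isUnit_iff_constantCoeff]
      simpa [(Fact.out : p.Prime).ne_zero] using hf
    have : Subsingleton (PowerSeries (MvPowerSeries (Fin n) K) ⧸
        Ideal.span {(PowerSeries.X ^ p ^ d + PowerSeries.C f :
          PowerSeries (MvPowerSeries (Fin n) K))}) :=
      Ideal.Quotient.subsingleton_iff.mpr (Ideal.span_singleton_eq_top.mpr hu)
    exact FFRT.hasFFRT_of_subsingleton p _
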